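/- Let $ABC$ be a non-degenerate triangle in the Euclidean plane with no obtuse angle, with edge lengths $a=|BC|$, $b=|CA|$, $c=|AB|$ satisfying $a\ge b\ge c$, and let $\tau$ be its area. An exit is placed at an unknown point of the perimeter of $ABC$. In the algorithm OppositeSearch, two agents start at the same point $S$ of the perimeter at time $0$ and move along the perimeter at unit speed in opposite directions; at the first time at which one of them is at the exit, the other one is informed instantaneously and moves at unit speed along the straight segment to the exit. The evacuation time for a given placement of the exit is the time at which the last agent reaches the exit, and the worst-case evacuation cost for the starting point $S$ is the supremum of the evacuation times over all placements of the exit on the perimeter. Then for every starting point $S$ on the largest edge $BC$ the worst-case evacuation cost is well defined and finite. As $S$ ranges over the edge $BC$, the smallest and the largest worst-case evacuation costs $l_a(a,b,c)$ and $u_a(a,b,c)$ are both attained, and $$l_a(a,b,c)=\min\left\{\,b+c,\ \frac{(a+b)^2-c^2+4\sqrt3\,\tau}{4b}\right\},\qquad u_a(a,b,c)=\frac a2+b+\frac c2 .$$ -/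

import Mathlib

namespace OppositeSearch

/-- The Euclidean plane. -/
abbrev Plane : Type := EuclideanSpace ℝ (Fin 2)

/-- Position at time `t ≥ 0` of an agent that leaves `P` at time `0` and visits the listed points in
order, moving along straight segments at unit speed, and stops at the last one. -/
noncomputable def walk : Plane → List Plane → ℝ → Plane
  | P, [], _ => P
  | P, Q :: L, t =>
      if t ≤ dist P Q then AffineMap.lineMap P Q (t / dist P Q) else walk Q L (t - dist P Q)

/-- The perimeter of the triangle `ABC`. -/
def perimeter (A B C : Plane) : Set Plane :=
  segment ℝ A B ∪ segment ℝ B C ∪ segment ℝ C A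

/-- The search trajectory of the first agent, started at `S` on the edge `BC`: once around the
perimeter, towards `B` first. -/
noncomputable def agent₁ (A B C S : Plane) : ℝ → Plane := walk S [B, A, C, S]

/-- The search trajectory of the second agent, started at `S` on the edge `BC`: once around the
perimeter in the opposite direction, towards `C` first. -/
noncomputable def agent₂ (A B C S : Plane) : ℝ → Plane := walk S [C, A, B, S]

/-- The exit at `I` is found at time `t`, the first time at which one of the agents is at `I`. -/
def IsDetectionTime (A B C S I : Plane) (t : ℝ) : Prop :=
  IsLeast {s : ℝ | 0 ≤ s ∧ (agent₁ A B C S s = I ∨ agent₂ A B C S s = I)} t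

/-- The time `T` at which the last agent reaches the exit at `I`: when the exit is found, both agents
are told at once and go to it at unit speed along the straight segment (for the finder this
segment is a point). -/
def IsEvacuationTime (A B C S I : Plane) (T : ℝ) : Prop :=
  ∃ t : ℝ, IsDetectionTime A B C S I t ∧
    T = t + max (dist (agent₁ A B C S t) I) (dist (agent₂ A B C S t) I)

/-- `T` is the worst-case evacuation cost for the starting point `S` on the edge `BC`: wherever the
exit is on the perimeter the agents evacuate, and `T` is the supremum of the evacuation times
over all placements of the exit. -/
def IsWorstCaseCost (A B C S : Plane) (T : ℝ) : Prop :=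
  (∀ I ∈ perimeter A B C, ∃ τ : ℝ, IsEvacuationTime A B C S I τ) ∧
    IsLUB {τ : ℝ | ∃ I ∈ perimeter A B C, IsEvacuationTime A B C S I τ} T

/-- The triangle `ABC` is nondegenerate and has no angle larger than a right angle. -/
def IsNonObtuse (A B C : Plane) : Prop :=
  AffineIndependent ℝ ![A, B, C] ∧
    EuclideanGeometry.angle B A C ≤ Real.pi / 2 ∧
    EuclideanGeometry.angle A B C ≤ Real.pi / 2 ∧
    EuclideanGeometry.angle A C B ≤ Real.pi / 2

/-- The area of the triangle `ABC`. -/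
noncomputable def area (A B C : Plane) : ℝ :=
  (MeasureTheory.volume (convexHull ℝ ({A, B, C} : Set Plane))).toReal

end OppositeSearch

namespace OppositeSearch

/-! Let `x = |SB|` and `y = |SC|`. When the exit is found at time `t`, one agent stands on it, so
the evacuation time is `cost t = t + dist (agent₁ t) (agent₂ t)`, and `t` is at most the half
perimeter. While neither agent turns a corner both motions are affine in `t`, so the cost is convex
there. Hence (`cost_le`) it is bounded by its values at the corner times `x`, `y`, `x + c`, `y + b`
and at the half perimeter, where the agents meet.

Lower bound. Only exits at `B` and `C` are used. Suppose `y ≤ x` and put `s = x - y`. If `s ≥ b`, an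
exit at `B` costs `y + b + c ≥ b + c`. Otherwise it costs `(a + s)/2 + D`, where `D` is the distance
from `B` to the point of `CA` at distance `s` from `C`. By Heron, `(2bD)² = (a² + b² - c² - 2bs)² +
(4τ)²`, and Cauchy–Schwarz against `(1, √3)` gives the second term of the minimum (`min_le_cost_x`).
The case `x ≤ y` is the mirror image with `b` and `c` exchanged, and its bound is no smaller
(`optimal_cost_le_swap`).

Attainment. `S = B` gives `b + c`. The equality case of Cauchy–Schwarz gives the other value,
because at that `S` the remaining corner times cost no more (`cost_le_of_optimal`).

Maximum. Replacing distances by their convex upper bounds makes the corner costs affine in `x` or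
constant, and comparing endpoints gives `a/2 + b + c/2`. The value is reached when the agents arrive
at `A` and `C` simultaneously. -/

/-! ### Trajectories -/

theorem walk_zero (P : Plane) (L : List Plane) : walk P L 0 = P := by
  cases L <;> simp [walk, dist_nonneg]

theorem walk_of_le {P Q : Plane} {L : List Plane} {t : ℝ} (h : t ≤ dist P Q) :
    walk P (Q :: L) t = AffineMap.lineMap P Q (t / dist P Q) := by
  rw [walk, if_pos h]

theorem walk_of_ge {P Q : Plane} {L : List Plane} {t : ℝ} (h : dist P Q ≤ t) :
    walk P (Q :: L) t = walk Q L (t - dist P Q) := by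
  rcases h.eq_or_lt with h | h
  · subst h
    rw [walk_of_le le_rfl, sub_self, walk_zero]
    -- If `P = Q` the parameter is `0 / 0 = 0`, which is harmless on a constant segment.
    rcases eq_or_ne P Q with rfl | hPQ
    · simp
    · rw [div_self (dist_ne_zero.2 hPQ), AffineMap.lineMap_apply_one]
  · rw [walk, if_neg h.not_ge]

theorem continuous_walk (P : Plane) (L : List Plane) : Continuous (walk P L) := by
  induction L generalizing P with
  | nil => exact continuous_const
  | cons Q L ih =>
    have hf : walk P (Q :: L) = fun t => if t ≤ dist P Q then
        AffineMap.lineMap P Q (t / dist P Q) else walk Q L (t - dist P Q) := by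
      ext1 t; rw [walk]
    rw [hf]
    refine Continuous.if_le ?_ ?_ continuous_id continuous_const ?_
    · exact AffineMap.lineMap_continuous.comp (continuous_id.div_const _)
    · exact (ih Q).comp (continuous_id.sub continuous_const)
    · rintro t rfl
      rw [← walk_of_le (L := L) le_rfl, walk_of_ge le_rfl]

/-- A triangle `ABC` with side lengths `a`, `b`, `c` and a point `S` of the edge `BC` at distance
`x` from `B` and `y` from `C`. -/
structure Config (A B C S : Plane) (a b c x y : ℝ) : Prop where
  dist_BC : dist B C = a
  dist_CA : dist C A = b
  dist_AB : dist A B = c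
  a_pos : 0 < a
  b_pos : 0 < b
  c_pos : 0 < c
  x_nonneg : 0 ≤ x
  y_nonneg : 0 ≤ y
  add_eq : x + y = a
  b_lt : b < a + c
  c_lt : c < a + b
  S_eq : S = AffineMap.lineMap B C (x / a)

namespace Config

variable {A B C S : Plane} {a b c x y : ℝ}

/-- Reflection exchanging `B` with `C` and the two agents. `Config` leaves `b` and `c` unordered so
that every statement about one agent transfers to the other. -/
theorem swap (h : Config A B C S a b c x y) : Config A C B S a c b y x where
  dist_BC := by rw [dist_comm, h.dist_BC]
  dist_CA := by rw [dist_comm, h.dist_AB]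
  dist_AB := by rw [dist_comm, h.dist_CA]
  a_pos := h.a_pos
  b_pos := h.c_pos
  c_pos := h.b_pos
  x_nonneg := h.y_nonneg
  y_nonneg := h.x_nonneg
  add_eq := by rw [add_comm, h.add_eq]
  b_lt := h.c_lt
  c_lt := h.b_lt
  S_eq := by
    rw [h.S_eq, ← AffineMap.lineMap_apply_one_sub]
    congr 1
    have := h.a_pos
    field_simp
    linarith [h.add_eq]

theorem a_le (h : Config A B C S a b c x y) : a ≤ b + c := by
  have := dist_triangle B A C
  rw [dist_comm B A, dist_comm A C, h.dist_BC, h.dist_CA, h.dist_AB] at this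
  linarith

theorem dist_SB (h : Config A B C S a b c x y) : dist S B = x := by
  have := h.a_pos
  rw [h.S_eq, dist_lineMap_left, h.dist_BC, Real.norm_eq_abs,
    abs_of_nonneg (div_nonneg h.x_nonneg h.a_pos.le)]
  field_simp

theorem agent₁_first (h : Config A B C S a b c x y) {t : ℝ} (h0 : 0 ≤ t) (ht : t ≤ x) :
    agent₁ A B C S t = AffineMap.lineMap B C ((x - t) / a) := by
  have ha := h.a_pos
  rw [agent₁, walk_of_le (by rwa [h.dist_SB]), h.dist_SB, h.S_eq]
  have : (x - t) / a = (1 - t / x) * (x / a) := by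
    rcases h.x_nonneg.eq_or_lt with h' | h'
    · rw [← h'] at ht ⊢
      simp [le_antisymm ht h0]
    · field_simp
  rw [this]
  simp only [AffineMap.lineMap_apply_module]
  module

theorem agent₁_second (h : Config A B C S a b c x y) {t : ℝ} (h0 : x ≤ t) (ht : t ≤ x + c) :
    agent₁ A B C S t = AffineMap.lineMap B A ((t - x) / c) := by
  have hBA : dist B A = c := by rw [dist_comm, h.dist_AB]
  rw [agent₁, walk_of_ge (by rwa [h.dist_SB]), h.dist_SB, walk_of_le (by rw [hBA]; linarith), hBA]

theorem agent₁_third (h : Config A B C S a b c x y) {t : ℝ} (h0 : x + c ≤ t)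
    (ht : t ≤ x + c + b) :
    agent₁ A B C S t = AffineMap.lineMap A C ((t - x - c) / b) := by
  have hBA : dist B A = c := by rw [dist_comm, h.dist_AB]
  have hAC : dist A C = b := by rw [dist_comm, h.dist_CA]
  have := h.c_pos
  rw [agent₁, walk_of_ge (by rw [h.dist_SB]; linarith), h.dist_SB,
    walk_of_ge (by rw [hBA]; linarith), hBA, walk_of_le (by rw [hAC]; linarith), hAC]

theorem agent₁_at_B (h : Config A B C S a b c x y) : agent₁ A B C S x = B := by
  rw [h.agent₁_first h.x_nonneg le_rfl]; simp

theorem agent₁_at_A (h : Config A B C S a b c x y) : agent₁ A B C S (x + c) = A := by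
  have := h.b_pos
  rw [h.agent₁_third le_rfl (by linarith)]; simp

end Config

theorem agent₁_swap (A B C S : Plane) : agent₁ A C B S = agent₂ A B C S := rfl

theorem agent₂_swap (A B C S : Plane) : agent₂ A C B S = agent₁ A B C S := rfl

/-! ### Detection times and evacuation costs -/

theorem isDetectionTime_swap {A B C S I : Plane} {t : ℝ} :
    IsDetectionTime A C B S I t ↔ IsDetectionTime A B C S I t := by
  unfold IsDetectionTime
  simp only [agent₁_swap A B, agent₂_swap A B, or_comm]

theorem isEvacuationTime_swap {A B C S I : Plane} {t : ℝ} :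
    IsEvacuationTime A C B S I t ↔ IsEvacuationTime A B C S I t := by
  unfold IsEvacuationTime
  simp only [agent₁_swap A B, agent₂_swap A B, isDetectionTime_swap (A := A) (B := B), max_comm]

/-- The evacuation time for an exit found at time `t`. -/
noncomputable def cost (A B C S : Plane) (t : ℝ) : ℝ :=
  t + dist (agent₁ A B C S t) (agent₂ A B C S t)

theorem cost_swap (A B C S : Plane) (t : ℝ) : cost A C B S t = cost A B C S t := by
  rw [cost, cost, agent₁_swap A B, agent₂_swap A B, dist_comm]

theorem isEvacuationTime_of_isDetectionTime {A B C S I : Plane} {t : ℝ}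
    (h : IsDetectionTime A B C S I t) : IsEvacuationTime A B C S I (cost A B C S t) := by
  refine ⟨t, h, ?_⟩
  rcases h.1.2 with h | h <;> simp [cost, ← h, dist_comm]

namespace Config

variable {A B C S : Plane} {a b c x y : ℝ}

/-- The second agent cannot reach `B` before time `x`: on `CA` this would force `b = a + c`, and
along `AB` it arrives only at `y + b + c ≥ x`. -/
theorem isDetectionTime_B (h : Config A B C S a b c x y) : IsDetectionTime A B C S B x := by
  have ha := h.a_pos
  have hb := h.b_pos
  have hc := h.c_pos
  have hx := h.x_nonneg
  have hy := h.y_nonneg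
  have hxy := h.add_eq
  have hle := h.a_le
  refine ⟨⟨hx, Or.inl h.agent₁_at_B⟩, ?_⟩
  rintro s ⟨hs, hs'⟩
  by_contra! hlt
  rcases hs' with hs' | hs'
  · rw [h.agent₁_first hs hlt.le, AffineMap.lineMap_eq_left_iff] at hs'
    rcases hs' with hs' | hs'
    · exact ha.ne' (by rw [← h.dist_BC, hs', dist_self])
    · rw [div_eq_zero_iff] at hs'
      rcases hs' with hs' | hs' <;> linarith
  · rw [← agent₁_swap] at hs'
    rcases le_total s y with h1 | h1
    · rw [h.swap.agent₁_first hs h1, AffineMap.lineMap_eq_right_iff] at hs'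
      rcases hs' with hs' | hs'
      · exact ha.ne' (by rw [← h.dist_BC, hs', dist_self])
      · rw [div_eq_one_iff_eq ha.ne'] at hs'
        linarith
    · rcases le_total s (y + b) with h2 | h2
      · rw [h.swap.agent₁_second h1 h2] at hs'
        have h3 : 0 ≤ (s - y) / b := div_nonneg (by linarith) hb.le
        have h4 : (s - y) / b ≤ 1 := (div_le_one hb).2 (by linarith)
        have h5 := dist_lineMap_left C A ((s - y) / b)
        have h6 := dist_lineMap_right C A ((s - y) / b)
        rw [hs', h.dist_CA, Real.norm_of_nonneg h3, h.dist_BC] at h5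
        rw [hs', h.dist_CA, Real.norm_of_nonneg (by linarith), dist_comm, h.dist_AB] at h6
        linarith [h.b_lt]
      · rw [h.swap.agent₁_third h2 (by linarith), AffineMap.lineMap_eq_right_iff] at hs'
        rcases hs' with hs' | hs'
        · exact hc.ne' (by rw [← h.dist_AB, hs', dist_self])
        · rw [div_eq_one_iff_eq hc.ne'] at hs'
          linarith

/-- The two agents' arrival times at a given point of `AB` add up to the perimeter, so one of them
is at most half of it. -/
theorem exists_mem_AB (h : Config A B C S a b c x y) {I : Plane} (hI : I ∈ segment ℝ A B) :
    ∃ t, 0 ≤ t ∧ t ≤ (a + b + c) / 2 ∧ (agent₁ A B C S t = I ∨ agent₂ A B C S t = I) := by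
  have hc := h.c_pos
  have hx := h.x_nonneg
  have hy := h.y_nonneg
  have hxy := h.add_eq
  have hb := h.b_pos
  rw [segment_eq_image_lineMap] at hI
  obtain ⟨r, ⟨hr0, hr1⟩, rfl⟩ := hI
  have hr0' : 0 ≤ c * r := by positivity
  have hr1' : 0 ≤ c * (1 - r) := mul_nonneg hc.le (by linarith)
  rcases le_total (x + c * (1 - r)) ((a + b + c) / 2) with h1 | h1
  · refine ⟨x + c * (1 - r), by linarith, h1, Or.inl ?_⟩
    rw [h.agent₁_second (by linarith) (by linarith), ← AffineMap.lineMap_apply_one_sub]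
    congr 1
    field_simp
    ring
  · refine ⟨y + b + c * r, by linarith, by linarith, Or.inr ?_⟩
    rw [← agent₁_swap, h.swap.agent₁_third (by linarith) (by linarith)]
    congr 1
    field_simp
    ring

theorem exists_mem_perimeter (h : Config A B C S a b c x y) {I : Plane}
    (hI : I ∈ perimeter A B C) :
    ∃ t, 0 ≤ t ∧ t ≤ (a + b + c) / 2 ∧ (agent₁ A B C S t = I ∨ agent₂ A B C S t = I) := by
  have ha := h.a_pos
  have hx := h.x_nonneg
  have hy := h.y_nonneg
  have hxy := h.add_eq
  have hle := h.a_le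
  rcases hI with (hI | hI) | hI
  · exact h.exists_mem_AB hI
  · rw [segment_eq_image_lineMap] at hI
    obtain ⟨r, ⟨hr0, hr1⟩, rfl⟩ := hI
    have hr0' : 0 ≤ a * r := by positivity
    have hr1' : 0 ≤ a * (1 - r) := mul_nonneg ha.le (by linarith)
    rcases le_total (a * r) x with h1 | h1
    · refine ⟨x - a * r, by linarith, by linarith, Or.inl ?_⟩
      rw [h.agent₁_first (by linarith) (by linarith)]
      congr 1
      field_simp
      ring
    · refine ⟨a * r - x, by linarith, by linarith, Or.inr ?_⟩
      rw [← agent₁_swap, h.swap.agent₁_first (by linarith) (by linarith),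
        ← AffineMap.lineMap_apply_one_sub]
      congr 1
      field_simp
      linarith
  · rw [segment_symm] at hI
    obtain ⟨t, h0, h1, h2⟩ := h.swap.exists_mem_AB hI
    exact ⟨t, h0, by linarith, h2.symm⟩

theorem exists_isDetectionTime (h : Config A B C S a b c x y) {I : Plane}
    (hI : I ∈ perimeter A B C) : ∃ t, IsDetectionTime A B C S I t := by
  have hcl : IsClosed {s : ℝ | 0 ≤ s ∧ (agent₁ A B C S s = I ∨ agent₂ A B C S s = I)} := by
    refine isClosed_Ici.inter (IsClosed.union ?_ ?_)
    · exact isClosed_singleton.preimage (continuous_walk _ _)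
    · exact isClosed_singleton.preimage (continuous_walk _ _)
  obtain ⟨t, h0, -, h1⟩ := h.exists_mem_perimeter hI
  have hbdd : BddBelow {s : ℝ | 0 ≤ s ∧ (agent₁ A B C S s = I ∨ agent₂ A B C S s = I)} :=
    ⟨0, fun s hs => hs.1⟩
  exact ⟨_, hcl.csInf_mem ⟨t, h0, h1⟩ hbdd, fun s hs => csInf_le hbdd hs⟩

/-- This inclusion suffices for upper bounds; the lower bounds use exits at `B` and `C` alone. -/
theorem evacuation_eq_cost (h : Config A B C S a b c x y) {I : Plane} (hI : I ∈ perimeter A B C)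
    {T : ℝ} (hT : IsEvacuationTime A B C S I T) :
    ∃ t, 0 ≤ t ∧ t ≤ (a + b + c) / 2 ∧ T = cost A B C S t := by
  obtain ⟨t, ht, rfl⟩ := hT
  obtain ⟨s, h0, h1, h2⟩ := h.exists_mem_perimeter hI
  refine ⟨t, ht.1.1, (ht.2 ⟨h0, h2⟩).trans h1, ?_⟩
  rcases ht.1.2 with h | h <;> simp [cost, ← h, dist_comm]

theorem isEvacuationTime_B (h : Config A B C S a b c x y) :
    IsEvacuationTime A B C S B (cost A B C S x) :=
  isEvacuationTime_of_isDetectionTime h.isDetectionTime_B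

theorem isEvacuationTime_C (h : Config A B C S a b c x y) :
    IsEvacuationTime A B C S C (cost A B C S y) := by
  rw [← isEvacuationTime_swap, ← cost_swap]
  exact h.swap.isEvacuationTime_B

theorem B_mem_perimeter : B ∈ perimeter A B C := Or.inl (Or.inr (left_mem_segment ℝ B C))

theorem C_mem_perimeter : C ∈ perimeter A B C := Or.inl (Or.inr (right_mem_segment ℝ B C))

theorem cost_x_le_worst (h : Config A B C S a b c x y) {T : ℝ} (hT : IsWorstCaseCost A B C S T) :
    cost A B C S x ≤ T :=
  hT.2.1 ⟨B, B_mem_perimeter, h.isEvacuationTime_B⟩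

theorem cost_y_le_worst (h : Config A B C S a b c x y) {T : ℝ} (hT : IsWorstCaseCost A B C S T) :
    cost A B C S y ≤ T :=
  hT.2.1 ⟨C, C_mem_perimeter, h.isEvacuationTime_C⟩

theorem exists_isEvacuationTime (h : Config A B C S a b c x y) {I : Plane}
    (hI : I ∈ perimeter A B C) : ∃ T, IsEvacuationTime A B C S I T :=
  let ⟨_, ht⟩ := h.exists_isDetectionTime hI
  ⟨_, isEvacuationTime_of_isDetectionTime ht⟩

/-- An upper bound of the cost function bounds a worst-case cost. -/
theorem exists_isWorstCaseCost (h : Config A B C S a b c x y) {T : ℝ}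
    (hT : ∀ t, 0 ≤ t → t ≤ (a + b + c) / 2 → cost A B C S t ≤ T) :
    ∃ T' ≤ T, IsWorstCaseCost A B C S T' := by
  have hub : T ∈ upperBounds {τ : ℝ | ∃ I ∈ perimeter A B C, IsEvacuationTime A B C S I τ} := by
    rintro τ ⟨I, hI, hτ⟩
    obtain ⟨t, h0, h1, rfl⟩ := h.evacuation_eq_cost hI hτ
    exact hT t h0 h1
  have hne : {τ : ℝ | ∃ I ∈ perimeter A B C, IsEvacuationTime A B C S I τ}.Nonempty :=
    ⟨_, B, B_mem_perimeter, h.isEvacuationTime_B⟩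
  have hlub := isLUB_csSup hne ⟨T, hub⟩
  exact ⟨_, hlub.2 hub, fun I hI => h.exists_isEvacuationTime hI, hlub⟩

end Config

/-! ### Area and metric identities -/

open MeasureTheory in
theorem volume_standard_triangle :
    volume {p : ℝ × ℝ | 0 ≤ p.1 ∧ 0 ≤ p.2 ∧ p.1 + p.2 ≤ 1} = ENNReal.ofReal (1 / 2) := by
  have hm : MeasurableSet {p : ℝ × ℝ | 0 ≤ p.1 ∧ 0 ≤ p.2 ∧ p.1 + p.2 ≤ 1} :=
    (measurableSet_le measurable_const measurable_fst).inter
      ((measurableSet_le measurable_const measurable_snd).inter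
        (measurableSet_le (measurable_fst.add measurable_snd) measurable_const))
  rw [Measure.volume_eq_prod, Measure.prod_apply hm]
  have hs : ∀ x : ℝ, volume (Prod.mk x ⁻¹' {p : ℝ × ℝ | 0 ≤ p.1 ∧ 0 ≤ p.2 ∧ p.1 + p.2 ≤ 1}) =
      (Set.Icc (0 : ℝ) 1).indicator (fun x => ENNReal.ofReal (1 - x)) x := by
    intro x
    by_cases hx : x ∈ Set.Icc (0 : ℝ) 1
    · rw [Set.indicator_of_mem hx]
      have : Prod.mk x ⁻¹' {p : ℝ × ℝ | 0 ≤ p.1 ∧ 0 ≤ p.2 ∧ p.1 + p.2 ≤ 1} =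
          Set.Icc 0 (1 - x) := by
        ext y
        simp only [Set.mem_preimage, Set.mem_ofPred_eq, Set.mem_Icc, hx.1, true_and]
        exact and_congr_right fun _ => ⟨fun h => by linarith, fun h => by linarith⟩
      rw [this, Real.volume_Icc, sub_zero]
    · rw [Set.indicator_of_notMem hx, ← measure_empty (μ := volume (α := ℝ))]
      congr 1
      ext y
      simp only [Set.mem_preimage, Set.mem_ofPred_eq, Set.mem_empty_iff_false, iff_false]
      exact fun h => hx ⟨h.1, by linarith [h.2.1, h.2.2]⟩
  simp_rw [hs]
  rw [lintegral_indicator measurableSet_Icc, ← ofReal_integral_eq_lintegral_ofReal]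
  · congr 1
    rw [integral_Icc_eq_integral_Ioc, ← intervalIntegral.integral_of_le zero_le_one,
      intervalIntegral.integral_sub (by simp) (by simp)]
    simp
    norm_num
  · exact Continuous.integrableOn_Icc (by fun_prop)
  · filter_upwards [ae_restrict_mem measurableSet_Icc] with x hx
    simpa using hx.2

open MeasureTheory in
theorem volume_standard_triangle' :
    volume {w : Plane | 0 ≤ w 0 ∧ 0 ≤ w 1 ∧ w 0 + w 1 ≤ 1} = ENNReal.ofReal (1 / 2) := by
  have hm : MeasurableSet {p : ℝ × ℝ | 0 ≤ p.1 ∧ 0 ≤ p.2 ∧ p.1 + p.2 ≤ 1} :=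
    (measurableSet_le measurable_const measurable_fst).inter
      ((measurableSet_le measurable_const measurable_snd).inter
        (measurableSet_le (measurable_fst.add measurable_snd) measurable_const))
  rw [← volume_standard_triangle]
  exact ((volume_preserving_finTwoArrow ℝ).comp
    (PiLp.volume_preserving_ofLp (Fin 2))).measure_preimage hm.nullMeasurableSet

/-- Barycentric coordinates present the triangle as an affine image of the standard one, so its area
is a determinant times `1/2`. -/
theorem convexHull_triple_eq_image (A B C : Plane) :
    convexHull ℝ ({A, B, C} : Set Plane) = (fun w => A + w) ''
      ((Matrix.toLpLin 2 2 !![B 0 - A 0, C 0 - A 0; B 1 - A 1, C 1 - A 1]) ''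
        {w : Plane | 0 ≤ w 0 ∧ 0 ≤ w 1 ∧ w 0 + w 1 ≤ 1}) := by
  have key : ∀ w : Plane,
      A + Matrix.toLpLin 2 2 !![B 0 - A 0, C 0 - A 0; B 1 - A 1, C 1 - A 1] w =
        (1 - w 0 - w 1) • A + w 0 • B + w 1 • C := by
    intro w
    ext i
    fin_cases i <;>
      simp [Matrix.toLpLin_apply, dotProduct, Fin.sum_univ_two] <;> ring
  rw [Set.image_image]
  simp only [key]
  apply Set.Subset.antisymm
  · apply convexHull_min
    · rintro P (rfl | rfl | rfl)
      · exact ⟨0, by simp, by simp⟩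
      · exact ⟨!₂[1, 0], by simp, by simp⟩
      · exact ⟨!₂[0, 1], by simp, by simp⟩
    · rintro _ ⟨v, ⟨hv0, hv1, hv2⟩, rfl⟩ _ ⟨w, ⟨hw0, hw1, hw2⟩, rfl⟩ r s hr hs hrs
      refine ⟨r • v + s • w, ⟨?_, ?_, ?_⟩, ?_⟩
      · simp; positivity
      · simp; positivity
      · simp; nlinarith
      · obtain rfl : s = 1 - r := by linarith
        simp only [PiLp.add_apply, PiLp.smul_apply, smul_eq_mul]
        module
  · rintro _ ⟨w, ⟨h0, h1, h2⟩, rfl⟩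
    have h := (convex_convexHull ℝ ({A, B, C} : Set Plane)).sum_mem (t := Finset.univ)
      (w := ![1 - w 0 - w 1, w 0, w 1]) (z := ![A, B, C])
      (by intro i _; fin_cases i <;> simp <;> linarith)
      (by simp [Fin.sum_univ_three]; ring)
      (by intro i _; apply subset_convexHull; fin_cases i <;> simp)
    simpa [Fin.sum_univ_three] using h

open MeasureTheory in
/-- The area of a triangle is half the absolute value of the determinant of two edge vectors. -/
theorem area_eq_det (A B C : Plane) :
    area A B C = |(B 0 - A 0) * (C 1 - A 1) - (C 0 - A 0) * (B 1 - A 1)| / 2 := by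
  rw [area, convexHull_triple_eq_image, Set.image_add_left, measure_preimage_add,
    Measure.addHaar_image_linearMap, volume_standard_triangle', ENNReal.toReal_mul,
    ENNReal.toReal_ofReal (abs_nonneg _), ENNReal.toReal_ofReal (by norm_num),
    LinearMap.det_toLpLin, Matrix.det_fin_two_of]
  ring

theorem dist_sq_eq (P Q : Plane) : dist P Q ^ 2 = (P 0 - Q 0) ^ 2 + (P 1 - Q 1) ^ 2 := by
  rw [EuclideanSpace.dist_eq, Real.sq_sqrt (by positivity)]
  simp [Real.dist_eq]

/-- Heron's formula. -/
theorem four_mul_area_sq (A B C : Plane) :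
    16 * area A B C ^ 2 = 4 * dist C A ^ 2 * dist A B ^ 2 -
      (dist C A ^ 2 + dist A B ^ 2 - dist B C ^ 2) ^ 2 := by
  rw [area_eq_det, div_pow, sq_abs, dist_sq_eq, dist_sq_eq, dist_sq_eq]
  ring

theorem area_nonneg (A B C : Plane) : 0 ≤ area A B C := ENNReal.toReal_nonneg

/-- Stewart's theorem. -/
theorem dist_lineMap_sq (P Q R : Plane) (r : ℝ) :
    dist P (AffineMap.lineMap Q R r) ^ 2 =
      (1 - r) * dist P Q ^ 2 + r * dist P R ^ 2 - r * (1 - r) * dist Q R ^ 2 := by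
  simp only [dist_sq_eq, AffineMap.lineMap_apply_module, PiLp.add_apply, PiLp.smul_apply,
    smul_eq_mul]
  ring

theorem dist_lineMap_le (P Q R : Plane) {r : ℝ} (h0 : 0 ≤ r) (h1 : r ≤ 1) :
    dist P (AffineMap.lineMap Q R r) ≤ (1 - r) * dist P Q + r * dist P R := by
  have h := (convexOn_univ_dist P).2 (Set.mem_univ Q) (Set.mem_univ R)
    (sub_nonneg.2 h1) h0 (by ring)
  simpa [AffineMap.lineMap_apply_module, dist_comm] using h

theorem sq_le_of_angle_le_pi_div_two {A B C : Plane}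
    (h : EuclideanGeometry.angle B A C ≤ Real.pi / 2) :
    dist B C ^ 2 ≤ dist C A ^ 2 + dist A B ^ 2 := by
  have h1 := EuclideanGeometry.law_cos B A C
  have h2 : 0 ≤ Real.cos (EuclideanGeometry.angle B A C) :=
    Real.cos_nonneg_of_neg_pi_div_two_le_of_le
      (by linarith [EuclideanGeometry.angle_nonneg B A C, Real.pi_pos]) h
  rw [dist_comm A B]
  nlinarith [mul_nonneg (mul_nonneg (dist_nonneg (x := B) (y := A))
    (dist_nonneg (x := C) (y := A))) h2]

/-! ### Convexity of the cost between corner times -/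

/-- The motion `g` has constant velocity on `[l, r]`. -/
def UniformOn (g : ℝ → Plane) (l r : ℝ) : Prop :=
  ∃ p v : Plane, ∀ t, l ≤ t → t ≤ r → g t = p + t • v

theorem uniformOn_of_eq_lineMap {g : ℝ → Plane} {l r : ℝ} (P Q : Plane) (α β : ℝ)
    (h : ∀ t, l ≤ t → t ≤ r → g t = AffineMap.lineMap P Q (α + t * β)) : UniformOn g l r := by
  refine ⟨P + α • (Q - P), β • (Q - P), fun t h1 h2 => ?_⟩
  rw [h t h1 h2, AffineMap.lineMap_apply_module']
  module

/-- The cost is a convex function of time while both motions are uniform. -/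
theorem UniformOn.add_dist_le {g h : ℝ → Plane} {l r l' r' T t : ℝ} (hg : UniformOn g l r)
    (hh : UniformOn h l' r') (h1 : l ≤ t) (h2 : t ≤ r) (h3 : l' ≤ t) (h4 : t ≤ r')
    (hl : l' ≤ l → l + dist (g l) (h l) ≤ T) (hl' : l ≤ l' → l' + dist (g l') (h l') ≤ T)
    (hr : r ≤ r' → r + dist (g r) (h r) ≤ T) (hr' : r' ≤ r → r' + dist (g r') (h r') ≤ T) :
    t + dist (g t) (h t) ≤ T := by
  obtain ⟨p, v, hg⟩ := hg
  obtain ⟨q, w, hh⟩ := hh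
  have hc : ConvexOn ℝ Set.univ fun s : ℝ => s + ‖(p - q) + s • (v - w)‖ := by
    refine (convexOn_id convex_univ).add ⟨convex_univ, fun x _ y _ m n hm hn hmn => ?_⟩
    calc ‖(p - q) + (m • x + n • y) • (v - w)‖
        = ‖m • ((p - q) + x • (v - w)) + n • ((p - q) + y • (v - w))‖ := by
          congr 1
          obtain rfl : n = 1 - m := by linarith
          simp only [smul_eq_mul]
          module
      _ ≤ _ := by
          refine (norm_add_le _ _).trans ?_
          rw [norm_smul, norm_smul, Real.norm_of_nonneg hm, Real.norm_of_nonneg hn]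
          rfl
  have e : ∀ s, max l l' ≤ s → s ≤ min r r' →
      s + dist (g s) (h s) = s + ‖(p - q) + s • (v - w)‖ := by
    intro s hs hs'
    rw [hg s ((le_max_left _ _).trans hs) (hs'.trans (min_le_left _ _)),
      hh s ((le_max_right _ _).trans hs) (hs'.trans (min_le_right _ _)), dist_eq_norm]
    congr 2
    module
  have hml : max l l' ≤ t := max_le h1 h3
  have hmr : t ≤ min r r' := le_min h2 h4
  have hL : max l l' + dist (g (max l l')) (h (max l l')) ≤ T := by
    rcases le_total l l' with hll | hll
    · rw [max_eq_right hll]; exact hl' hll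
    · rw [max_eq_left hll]; exact hl hll
  have hR : min r r' + dist (g (min r r')) (h (min r r')) ≤ T := by
    rcases le_total r r' with hrr | hrr
    · rw [min_eq_left hrr]; exact hr hrr
    · rw [min_eq_right hrr]; exact hr' hrr
  rw [e _ le_rfl (hml.trans hmr)] at hL
  rw [e _ (hml.trans hmr) le_rfl] at hR
  rw [e _ hml hmr]
  have := hc.le_on_segment (Set.mem_univ (max l l')) (Set.mem_univ (min r r'))
    (by rw [segment_eq_Icc (hml.trans hmr)]; exact ⟨hml, hmr⟩)
  exact this.trans (max_le hL hR)

/-- With `q = 4τ/√3`, Heron also reads `3q² = 4a²b² - (a² + b² - c²)²`. As `c` is the shortest side,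
`a² + b² - c² ≥ ab` (the angle at `C` is at most 60°), whence `q ≤ ab`. This puts the optimal `s` at
`s ≥ 0`. -/
theorem le_of_heron {a b c q : ℝ} (ha : 0 < a) (hab : b ≤ a) (hbc : c ≤ b)
    (hb : 0 < b) (hc : 0 < c) (hq : 3 * q ^ 2 = 4 * b ^ 2 * c ^ 2 - (b ^ 2 + c ^ 2 - a ^ 2) ^ 2) :
    q ≤ a ^ 2 + b ^ 2 - c ^ 2 := by
  have hk : a * b ≤ a ^ 2 + b ^ 2 - c ^ 2 := by nlinarith
  refine (abs_le_of_sq_le_sq' ?_ (by nlinarith)).2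
  nlinarith [mul_self_le_mul_self (by positivity) hk]

namespace Config

variable {A B C S : Plane} {a b c x y : ℝ}

theorem uniformOn_first (h : Config A B C S a b c x y) : UniformOn (agent₁ A B C S) 0 x :=
  uniformOn_of_eq_lineMap B C (x / a) (-1 / a) fun t h1 h2 => by
    rw [h.agent₁_first h1 h2]; congr 1; ring

theorem uniformOn_second (h : Config A B C S a b c x y) :
    UniformOn (agent₁ A B C S) x (x + c) :=
  uniformOn_of_eq_lineMap B A (-x / c) (1 / c) fun t h1 h2 => by
    rw [h.agent₁_second h1 h2]; congr 1; ring

theorem uniformOn_third (h : Config A B C S a b c x y) :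
    UniformOn (agent₁ A B C S) (x + c) ((a + b + c) / 2) :=
  uniformOn_of_eq_lineMap A C ((-x - c) / b) (1 / b) fun t h1 h2 => by
    rw [h.agent₁_third h1 (by linarith [h.a_le, h.x_nonneg])]; congr 1; ring

theorem cost_zero : cost A B C S 0 = 0 := by
  simp [cost, agent₁, agent₂, walk_zero]

theorem cost_half_of_le (h : Config A B C S a b c x y) (hx : x + c ≤ (a + b + c) / 2) :
    cost A B C S ((a + b + c) / 2) = (a + b + c) / 2 := by
  have hxy := h.add_eq
  have hx0 := h.x_nonneg
  have hb := h.b_pos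
  have hle := h.a_le
  rw [cost, ← agent₁_swap, h.agent₁_third hx (by linarith),
    h.swap.agent₁_second (by linarith [h.b_lt]) (by linarith), ← AffineMap.lineMap_apply_one_sub]
  rw [dist_eq_zero.2, add_zero]
  congr 1
  field_simp
  linarith

theorem cost_half (h : Config A B C S a b c x y) :
    cost A B C S ((a + b + c) / 2) = (a + b + c) / 2 := by
  have hxy := h.add_eq
  rcases le_total (x + c) ((a + b + c) / 2) with h1 | h1
  · exact h.cost_half_of_le h1
  · rw [← cost_swap, add_right_comm]
    exact h.swap.cost_half_of_le (by linarith)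

/-- The cost function is bounded by its values at the times when an agent is at a vertex. -/
theorem cost_le (h : Config A B C S a b c x y) {T t : ℝ} (ht : 0 ≤ t)
    (ht' : t ≤ (a + b + c) / 2) (hT : (a + b + c) / 2 ≤ T)
    (h1 : cost A B C S x ≤ T) (h2 : cost A B C S y ≤ T)
    (h3 : x + c ≤ (a + b + c) / 2 → cost A B C S (x + c) ≤ T)
    (h4 : y + b ≤ (a + b + c) / 2 → cost A B C S (y + b) ≤ T) : cost A B C S t ≤ T := by
  have hle := h.a_le
  have ha := h.a_pos
  have hc0 : cost A B C S 0 ≤ T := by rw [cost_zero]; linarith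
  have hp : cost A B C S ((a + b + c) / 2) ≤ T := by rwa [h.cost_half]
  have hxp : x ≤ (a + b + c) / 2 := by linarith [h.y_nonneg, h.add_eq]
  have hyp : y ≤ (a + b + c) / 2 := by linarith [h.x_nonneg, h.add_eq]
  have hx0 := h.x_nonneg
  have hy0 := h.y_nonneg
  have u1 := h.uniformOn_first
  have u2 := h.uniformOn_second
  have u3 := h.uniformOn_third
  have v1 := h.swap.uniformOn_first
  have v2 := h.swap.uniformOn_second
  have v3 := h.swap.uniformOn_third
  rw [agent₁_swap] at v1 v2 v3
  rw [add_right_comm] at v3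
  have hxy := h.add_eq
  have hb := h.b_pos
  have hc := h.c_pos
  unfold cost at *
  have fin : ∀ {l r l' r' : ℝ}, UniformOn (agent₁ A B C S) l r → UniformOn (agent₂ A B C S) l' r' →
      l ≤ t → t ≤ r → l' ≤ t → t ≤ r' →
      (l = 0 ∨ l = x ∨ l = x + c) → (l' = 0 ∨ l' = y ∨ l' = y + b) →
      (r = x ∨ r = x + c ∨ r = (a + b + c) / 2) → (r' = y ∨ r' = y + b ∨ r' = (a + b + c) / 2) →
      t + dist (agent₁ A B C S t) (agent₂ A B C S t) ≤ T := by
    intro l r l' r' hu hv k1 k2 k3 k4 e1 e2 e3 e4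
    refine hu.add_dist_le hv k1 k2 k3 k4 (fun _ => ?_) (fun _ => ?_) (fun _ => ?_) (fun _ => ?_)
    · rcases e1 with rfl | rfl | rfl
      exacts [hc0, h1, h3 (by linarith)]
    · rcases e2 with rfl | rfl | rfl
      exacts [hc0, h2, h4 (by linarith)]
    · rcases e3 with rfl | rfl | rfl
      · exact h1
      · refine h3 ?_
        -- Since `(x + c) + (y + b)` is the perimeter, the smaller summand is at most half of it.
        rcases e4 with rfl | rfl | rfl <;> linarith
      · exact hp
    · rcases e4 with rfl | rfl | rfl
      · exact h2
      · refine h4 ?_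
        rcases e3 with rfl | rfl | rfl <;> linarith
      · exact hp
  rcases le_total t x with i1 | i1 <;> rcases le_total t y with j1 | j1
  · exact fin u1 v1 ht i1 ht j1 (by simp) (by simp) (by simp) (by simp)
  · rcases le_total t (y + b) with j2 | j2
    · exact fin u1 v2 ht i1 j1 j2 (by simp) (by simp) (by simp) (by simp)
    · exact fin u1 v3 ht i1 j2 ht' (by simp) (by simp) (by simp) (by simp)
  · rcases le_total t (x + c) with i2 | i2
    · exact fin u2 v1 i1 i2 ht j1 (by simp) (by simp) (by simp) (by simp)
    · exact fin u3 v1 i2 ht' ht j1 (by simp) (by simp) (by simp) (by simp)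
  · rcases le_total t (x + c) with i2 | i2 <;> rcases le_total t (y + b) with j2 | j2
    · exact fin u2 v2 i1 i2 j1 j2 (by simp) (by simp) (by simp) (by simp)
    · exact fin u2 v3 i1 i2 j2 ht' (by simp) (by simp) (by simp) (by simp)
    · exact fin u3 v2 i2 ht' j1 j2 (by simp) (by simp) (by simp) (by simp)
    · exact fin u3 v3 i2 ht' j2 ht' (by simp) (by simp) (by simp) (by simp)

/-! ### Costs at the corner times -/

theorem cost_x_of_le (h : Config A B C S a b c x y) (hxy : x ≤ y) :
    cost A B C S x = 3 * x := by
  have ha := h.a_pos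
  rw [cost, h.agent₁_at_B, ← agent₁_swap, h.swap.agent₁_first h.x_nonneg hxy, dist_comm,
    dist_lineMap_right, dist_comm, h.dist_BC, Real.norm_of_nonneg]
  · field_simp
    linarith [h.add_eq]
  · rw [sub_nonneg, div_le_one ha]
    linarith [h.add_eq, h.x_nonneg]

theorem cost_x_of_mem (h : Config A B C S a b c x y) (h1 : y ≤ x) (h2 : x ≤ y + b) :
    cost A B C S x = x + dist B (AffineMap.lineMap C A ((x - y) / b)) := by
  rw [cost, h.agent₁_at_B, ← agent₁_swap, h.swap.agent₁_second h1 h2]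

theorem cost_x_of_ge (h : Config A B C S a b c x y) (h1 : y + b ≤ x) :
    cost A B C S x = y + b + c := by
  have hc := h.c_pos
  have hxy := h.add_eq
  have hle := h.a_le
  have hy := h.y_nonneg
  rw [cost, h.agent₁_at_B, ← agent₁_swap, h.swap.agent₁_third h1 (by linarith), dist_comm,
    dist_lineMap_right, h.dist_AB, Real.norm_of_nonneg]
  · field_simp
    ring
  · rw [sub_nonneg, div_le_one hc]
    linarith

theorem cost_x_add_c_of_ge (h : Config A B C S a b c x y) (h1 : y ≤ x + c)
    (h2 : x + c ≤ (a + b + c) / 2) : cost A B C S (x + c) = y + b := by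
  have hb := h.b_pos
  have hxy := h.add_eq
  rw [cost, h.agent₁_at_A, ← agent₁_swap, h.swap.agent₁_second h1 (by linarith), dist_comm,
    dist_lineMap_right, h.dist_CA, Real.norm_of_nonneg]
  · field_simp
    ring
  · rw [sub_nonneg, div_le_one hb]
    linarith

theorem cost_x_add_c_of_le (h : Config A B C S a b c x y) (h1 : x + c ≤ y) :
    cost A B C S (x + c) ≤ x + c + ((1 - (y - x - c) / a) * b + (y - x - c) / a * c) := by
  have ha := h.a_pos
  have hc := h.c_pos
  have hx := h.x_nonneg
  have h2 := dist_lineMap_le A C B (r := (y - x - c) / a) (div_nonneg (by linarith) ha.le)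
    ((div_le_one ha).2 (by linarith [h.add_eq]))
  rw [dist_comm A C, h.dist_AB, h.dist_CA] at h2
  rw [cost, h.agent₁_at_A, ← agent₁_swap, h.swap.agent₁_first (by linarith) h1, ← sub_sub]
  linarith

/-- On the middle range the convexity bound for the distance is affine in `x`, with end values
`3a/2` at `x = y` and `(a + b)/2 + c` at `x = y + b`. -/
theorem cost_x_le (h : Config A B C S a b c x y) {T : ℝ} (h1 : 3 * a / 2 ≤ T)
    (h2 : (a + b) / 2 + c ≤ T) : cost A B C S x ≤ T := by
  have hxy := h.add_eq
  have hb := h.b_pos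
  rcases le_total x y with h3 | h3
  · rw [h.cost_x_of_le h3]; linarith
  rcases le_total x (y + b) with h4 | h4
  · have h5 : 0 ≤ (x - y) / b := div_nonneg (by linarith) hb.le
    have h6 : (x - y) / b ≤ 1 := (div_le_one hb).2 (by linarith)
    rw [h.cost_x_of_mem h3 h4]
    have h7 := dist_lineMap_le B C A h5 h6
    rw [dist_comm B A, h.dist_AB, h.dist_BC] at h7
    have h8 : x = (a + b * ((x - y) / b)) / 2 := by field_simp; linarith
    nlinarith [mul_le_mul_of_nonneg_left h1 (sub_nonneg.2 h6), mul_le_mul_of_nonneg_left h2 h5]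
  · rw [h.cost_x_of_ge h4]; linarith

/-- For `x + c ≤ y` the available bound is affine in `x`; the left sides of `h2` and `h1` are its
values at `x = 0` and at `x = (a - c)/2`. -/
theorem cost_x_add_c_le (h : Config A B C S a b c x y) {T : ℝ} (h1 : (a + c) / 2 + b ≤ T)
    (h2 : 2 * c + c * (b - c) / a ≤ T) (h3 : x + c ≤ (a + b + c) / 2) :
    cost A B C S (x + c) ≤ T := by
  have hxy := h.add_eq
  have ha := h.a_pos
  have hx := h.x_nonneg
  have hc := h.c_pos
  rcases le_total y (x + c) with h4 | h4
  · rw [h.cost_x_add_c_of_ge h4 h3]; linarith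
  · refine (h.cost_x_add_c_of_le h4).trans ?_
    rcases (show c ≤ a by linarith).eq_or_lt with h5 | h5
    · obtain rfl : x = 0 := by linarith
      have : y - 0 - c = 0 := by linarith
      rw [this]
      simp only [zero_div]
      linarith
    · have h6 : 0 ≤ 2 * x / (a - c) := div_nonneg (by linarith) (by linarith)
      have h7 : 2 * x / (a - c) ≤ 1 := (div_le_one (by linarith)).2 (by linarith)
      have h8 : x + c + ((1 - (y - x - c) / a) * b + (y - x - c) / a * c) =
          (1 - 2 * x / (a - c)) * (2 * c + c * (b - c) / a) +
            2 * x / (a - c) * ((a + c) / 2 + b) := by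
        obtain rfl : y = a - x := by linarith
        have : a - c ≠ 0 := by linarith
        field_simp
        ring
      rw [h8]
      nlinarith [mul_le_mul_of_nonneg_left h2 (sub_nonneg.2 h7), mul_le_mul_of_nonneg_left h1 h6]

/-! ### Bounds over all starting points -/

/-- The upper bound on the worst-case cost over all starting points of the largest edge. -/
theorem cost_le_upper (h : Config A B C S a b c x y) (hab : b ≤ a) (hbc : c ≤ b)
    (hobt : a ^ 2 ≤ b ^ 2 + c ^ 2) {t : ℝ} (ht : 0 ≤ t) (ht' : t ≤ (a + b + c) / 2) :
    cost A B C S t ≤ a / 2 + b + c / 2 := by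
  have ha := h.a_pos
  have hb := h.b_pos
  have hc := h.c_pos
  -- Equivalent to `a ≤ b + c/2`, which follows from `a² ≤ b² + c²` and `c ≤ b`.
  have h1 : 3 * a / 2 ≤ a / 2 + b + c / 2 := by nlinarith
  refine h.cost_le ht ht' (by linarith) (h.cost_x_le h1 (by linarith)) ?_ ?_ ?_
  · rw [← cost_swap]
    exact h.swap.cost_x_le h1 (by linarith)
  · refine h.cost_x_add_c_le (by linarith) ?_
    have : c * (b - c) / a ≤ b - c := by
      rw [div_le_iff₀ ha]
      nlinarith
    linarith
  · intro h2
    rw [← cost_swap]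
    refine h.swap.cost_x_add_c_le (by linarith) ?_ (by linarith)
    rw [← le_sub_iff_add_le', div_le_iff₀ ha]
    nlinarith [sq_nonneg (a - b), sq_nonneg (a - 2 * b), sq_nonneg (b - c),
      mul_nonneg (sub_nonneg.2 hab) (sub_nonneg.2 hbc), mul_nonneg (sub_nonneg.2 hab) hb.le,
      mul_nonneg (sub_nonneg.2 hab) hc.le, mul_nonneg (sub_nonneg.2 hbc) hc.le]

/-- Starting at `B`, the cost is at most `b + c`. -/
theorem cost_le_add (h : Config A B C S a b c 0 y) (hab : b ≤ a) (hbc : c ≤ b)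
    {t : ℝ} (ht : 0 ≤ t) (ht' : t ≤ (a + b + c) / 2) : cost A B C S t ≤ b + c := by
  have ha := h.a_pos
  have hb := h.b_pos
  have hc := h.c_pos
  have hy := h.add_eq
  refine h.cost_le ht ht' (by linarith [h.a_le]) ?_ ?_ ?_ ?_
  · rw [cost_zero]; linarith
  · rw [← cost_swap, h.swap.cost_x_of_ge (by linarith)]; linarith
  · intro _
    refine (h.cost_x_add_c_of_le (by linarith)).trans ?_
    have : 0 ≤ (y - 0 - c) / a := div_nonneg (by linarith) ha.le
    nlinarith
  · intro _; linarith

theorem min_le_cost_x (h : Config A B C S a b c x y) {τ : ℝ}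
    (hτ : 16 * τ ^ 2 = 4 * b ^ 2 * c ^ 2 - (b ^ 2 + c ^ 2 - a ^ 2) ^ 2) (hyx : y ≤ x) :
    min (b + c) (((a + b) ^ 2 - c ^ 2 + 4 * Real.sqrt 3 * τ) / (4 * b)) ≤ cost A B C S x := by
  have hb := h.b_pos
  have hxy := h.add_eq
  have h3 : Real.sqrt 3 ^ 2 = 3 := Real.sq_sqrt (by norm_num)
  rcases le_total (y + b) x with h1 | h1
  · rw [h.cost_x_of_ge h1]
    exact (min_le_left _ _).trans (by linarith [h.y_nonneg])
  · refine (min_le_right _ _).trans ?_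
    rw [h.cost_x_of_mem hyx h1]
    have hD := dist_lineMap_sq B C A ((x - y) / b)
    have hD0 := dist_nonneg (x := B) (y := AffineMap.lineMap C A ((x - y) / b))
    set D := dist B (AffineMap.lineMap C A ((x - y) / b)) with hDdef
    rw [dist_comm B A, h.dist_AB, h.dist_BC, h.dist_CA] at hD
    obtain ⟨s, hs⟩ : ∃ s, s = x - y := ⟨_, rfl⟩
    rw [← hs] at hD
    have hD' : 4 * b ^ 2 * D ^ 2 = (a ^ 2 + b ^ 2 - c ^ 2 - 2 * b * s) ^ 2 + 16 * τ ^ 2 := by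
      rw [hτ, hD]
      field_simp
      ring
    -- Cauchy–Schwarz: `u + √3 v ≤ 2 √(u² + v²)` with `v = 4τ`.
    have h4 : a ^ 2 + b ^ 2 - c ^ 2 - 2 * b * s + Real.sqrt 3 * (4 * τ) ≤ 4 * b * D := by
      refine (abs_le_of_sq_le_sq' ?_ (by positivity)).2
      nlinarith [sq_nonneg (Real.sqrt 3 * (a ^ 2 + b ^ 2 - c ^ 2 - 2 * b * s) - 4 * τ)]
    have h5 : x = (a + s) / 2 := by linarith
    rw [div_le_iff₀ (by positivity), h5]
    nlinarith

/-- For the starting point at which the exit at `B` is cheapest, no other exit is worse. -/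
theorem cost_le_of_optimal (h : Config A B C S a b c x y) (hab : b ≤ a) (hbc : c ≤ b)
    (hobt : a ^ 2 ≤ b ^ 2 + c ^ 2) {q : ℝ} (hq0 : 0 ≤ q)
    (hq : 3 * q ^ 2 = 4 * b ^ 2 * c ^ 2 - (b ^ 2 + c ^ 2 - a ^ 2) ^ 2)
    (hx : 2 * b * (2 * x - a) = a ^ 2 + b ^ 2 - c ^ 2 - q)
    {t : ℝ} (ht : 0 ≤ t) (ht' : t ≤ (a + b + c) / 2) :
    cost A B C S t ≤ ((a + b) ^ 2 - c ^ 2 + 3 * q) / (4 * b) := by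
  have ha := h.a_pos
  have hb := h.b_pos
  have hc := h.c_pos
  have hbc0 : 0 < b * c := by positivity
  have hw0 : 0 ≤ b ^ 2 + c ^ 2 - a ^ 2 := by linarith
  have hw : b ^ 2 + c ^ 2 - a ^ 2 ≤ b * c := by nlinarith
  have hk : a * b ≤ a ^ 2 + b ^ 2 - c ^ 2 := by nlinarith
  have hqk := le_of_heron ha hab hbc hb hc hq
  have hqbc : b * c ≤ q := by
    refine (abs_le_of_sq_le_sq' ?_ hq0).2
    nlinarith [mul_self_le_mul_self hw0 hw]
  obtain ⟨s, hs⟩ : ∃ s, s = 2 * x - a := ⟨_, rfl⟩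
  have hxs : x = (a + s) / 2 := by linarith
  have hys : y = (a - s) / 2 := by linarith [h.add_eq]
  rw [← hs] at hx
  have hs0 : 0 ≤ s := by
    by_contra! hneg
    nlinarith
  have hsb : s ≤ b := by
    by_contra! hlt
    nlinarith
  refine h.cost_le ht ht' ?_ ?_ ?_ (fun h1 => ?_) (fun h1 => ?_)
  · rw [le_div_iff₀ (by positivity)]
    nlinarith
  · rw [h.cost_x_of_mem (by linarith) (by linarith)]
    have hD := dist_lineMap_sq B C A ((x - y) / b)
    have hxy : x - y = s := by linarith
    rw [hxy] at hD ⊢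
    have hD0 := dist_nonneg (x := B) (y := AffineMap.lineMap C A (s / b))
    set D := dist B (AffineMap.lineMap C A (s / b))
    rw [dist_comm B A, h.dist_AB, h.dist_BC, h.dist_CA] at hD
    have hD' : 4 * b ^ 2 * D ^ 2 = (a ^ 2 + b ^ 2 - c ^ 2 - 2 * b * s) ^ 2 + 3 * q ^ 2 := by
      rw [hq, hD]
      field_simp
      ring
    -- Here `4b²D² = q² + 3q²`.
    have hDq : b * D ≤ q := by
      refine (abs_le_of_sq_le_sq' ?_ hq0).2
      rw [hx] at hD'
      nlinarith
    rw [le_div_iff₀ (by positivity), hxs]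
    nlinarith
  · rw [← cost_swap, h.swap.cost_x_of_le (by linarith), le_div_iff₀ (by positivity), hys]
    nlinarith
  · rw [h.cost_x_add_c_of_ge (by linarith) h1, le_div_iff₀ (by positivity), hys]
    nlinarith
  · rw [← cost_swap, h.swap.cost_x_add_c_of_ge (by linarith) (by linarith),
      le_div_iff₀ (by positivity), hxs]
    nlinarith

theorem cost_y_eq_upper (h : Config A B C S a b c x y) (hx : x + c = y) :
    cost A B C S y = a / 2 + b + c / 2 := by
  rw [← cost_swap, h.swap.cost_x_of_ge hx.le]
  linarith [h.add_eq]

end Config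

/-- After clearing denominators the difference is `(b - c)(4√3 τ - 2bc - (b² + c² - a²))`. The
second factor is nonnegative because the angle at `A`, being the largest, is at least 60°. -/
theorem optimal_cost_le_swap {a b c τ : ℝ} (hc : 0 < c) (hab : b ≤ a) (hbc : c ≤ b)
    (hobt : a ^ 2 ≤ b ^ 2 + c ^ 2) (hτ0 : 0 ≤ τ)
    (hτ : 16 * τ ^ 2 = 4 * b ^ 2 * c ^ 2 - (b ^ 2 + c ^ 2 - a ^ 2) ^ 2) :
    ((a + b) ^ 2 - c ^ 2 + 4 * Real.sqrt 3 * τ) / (4 * b) ≤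
      ((a + c) ^ 2 - b ^ 2 + 4 * Real.sqrt 3 * τ) / (4 * c) := by
  have hb : 0 < b := hc.trans_le hbc
  have h3 : Real.sqrt 3 ^ 2 = 3 := Real.sq_sqrt (by norm_num)
  have hw0 : 0 ≤ b ^ 2 + c ^ 2 - a ^ 2 := by linarith
  have hw : b ^ 2 + c ^ 2 - a ^ 2 ≤ b * c := by nlinarith
  have h1 : 2 * (b * c) + (b ^ 2 + c ^ 2 - a ^ 2) ≤ Real.sqrt 3 * (4 * τ) := by
    refine (abs_le_of_sq_le_sq' ?_ (by positivity)).2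
    rw [mul_pow, h3]
    nlinarith [mul_nonneg (show 0 ≤ 2 * (b * c) + (b ^ 2 + c ^ 2 - a ^ 2) by positivity)
      (sub_nonneg.2 hw)]
  rw [div_le_div_iff₀ (by positivity) (by positivity)]
  nlinarith [mul_nonneg (sub_nonneg.2 hbc) (sub_nonneg.2 h1)]

end OppositeSearch

/-! ### The main theorem -/

open OppositeSearch in
theorem mainTheorem2 (A B C : OppositeSearch.Plane) (a b c τ : ℝ)
    (hABC : OppositeSearch.IsNonObtuse A B C)
    (ha : a = dist B C) (hb : b = dist C A) (hc : c = dist A B)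
    (hab : b ≤ a) (hbc : c ≤ b) (hτ : τ = OppositeSearch.area A B C) :
    (∀ S ∈ segment ℝ B C, ∃ T : ℝ, OppositeSearch.IsWorstCaseCost A B C S T) ∧
    IsLeast {T : ℝ | ∃ S ∈ segment ℝ B C, OppositeSearch.IsWorstCaseCost A B C S T}
      (min (b + c) (((a + b) ^ 2 - c ^ 2 + 4 * Real.sqrt 3 * τ) / (4 * b))) ∧
    IsGreatest {T : ℝ | ∃ S ∈ segment ℝ B C, OppositeSearch.IsWorstCaseCost A B C S T}
      (a / 2 + b + c / 2) := by
  have hobt : a ^ 2 ≤ b ^ 2 + c ^ 2 := by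
    rw [ha, hb, hc]
    exact sq_le_of_angle_le_pi_div_two hABC.2.1
  have hc0 : 0 < c := by
    rw [hc, dist_pos]
    exact hABC.1.injective.ne (show (0 : Fin 3) ≠ 1 by decide)
  have hb0 : 0 < b := hc0.trans_le hbc
  have ha0 : 0 < a := hb0.trans_le hab
  have hblt : b < a + c := by linarith
  have hclt : c < a + b := by linarith
  have hle : a ≤ b + c := by
    rw [ha, hb, hc, dist_comm B C, dist_comm A B]
    linarith [dist_triangle C A B, dist_comm A B]
  have hτ0 : 0 ≤ τ := hτ ▸ area_nonneg A B C
  have hτ2 : 16 * τ ^ 2 = 4 * b ^ 2 * c ^ 2 - (b ^ 2 + c ^ 2 - a ^ 2) ^ 2 := by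
    rw [hτ, ha, hb, hc]
    exact four_mul_area_sq A B C
  have hcfg : ∀ x, 0 ≤ x → x ≤ a →
      Config A B C (AffineMap.lineMap B C (x / a)) a b c x (a - x) := fun x h0 h1 =>
    ⟨ha.symm, hb.symm, hc.symm, ha0, hb0, hc0, h0, sub_nonneg.2 h1, by ring, hblt, hclt, rfl⟩
  have hmem : ∀ x, 0 ≤ x → x ≤ a → AffineMap.lineMap B C (x / a) ∈ segment ℝ B C := by
    intro x h0 h1
    rw [segment_eq_image_lineMap]
    exact ⟨_, ⟨div_nonneg h0 ha0.le, (div_le_one ha0).2 h1⟩, rfl⟩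
  have hall : ∀ S ∈ segment ℝ B C, ∃ x, Config A B C S a b c x (a - x) := by
    intro S hS
    rw [segment_eq_image_lineMap] at hS
    obtain ⟨r, ⟨h0, h1⟩, rfl⟩ := hS
    refine ⟨a * r, ?_⟩
    have := hcfg (a * r) (by positivity) (mul_le_of_le_one_right ha0.le h1)
    rwa [mul_div_cancel_left₀ _ ha0.ne'] at this
  have hlow : ∀ S ∈ segment ℝ B C, ∀ T, IsWorstCaseCost A B C S T →
      min (b + c) (((a + b) ^ 2 - c ^ 2 + 4 * Real.sqrt 3 * τ) / (4 * b)) ≤ T := by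
    intro S hS T hT
    obtain ⟨x, h⟩ := hall S hS
    rcases le_total (a - x) x with h1 | h1
    · exact (h.min_le_cost_x hτ2 h1).trans (h.cost_x_le_worst hT)
    · refine le_trans (min_le_min (add_comm b c).le (optimal_cost_le_swap hc0 hab hbc hobt hτ0 hτ2)) ?_
      refine (h.swap.min_le_cost_x (by rw [hτ2]; ring) h1).trans ?_
      rw [cost_swap]
      exact h.cost_y_le_worst hT
  have hup : ∀ S ∈ segment ℝ B C, ∃ T ≤ a / 2 + b + c / 2, IsWorstCaseCost A B C S T := by
    intro S hS
    obtain ⟨x, h⟩ := hall S hS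
    exact h.exists_isWorstCaseCost fun t h0 h1 => h.cost_le_upper hab hbc hobt h0 h1
  refine ⟨fun S hS => ?_, ⟨?_, ?_⟩, ?_, ?_⟩
  · obtain ⟨T, -, hT⟩ := hup S hS
    exact ⟨T, hT⟩
  · have hsuff : ∀ x, 0 ≤ x → x ≤ a → (∀ t, 0 ≤ t → t ≤ (a + b + c) / 2 →
        cost A B C (AffineMap.lineMap B C (x / a)) t ≤
          min (b + c) (((a + b) ^ 2 - c ^ 2 + 4 * Real.sqrt 3 * τ) / (4 * b))) →
        ∃ S ∈ segment ℝ B C, IsWorstCaseCost A B C S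
          (min (b + c) (((a + b) ^ 2 - c ^ 2 + 4 * Real.sqrt 3 * τ) / (4 * b))) := by
      intro x h0 h1 hx
      obtain ⟨T, hT, hT'⟩ := (hcfg x h0 h1).exists_isWorstCaseCost hx
      refine ⟨_, hmem x h0 h1, ?_⟩
      rwa [← le_antisymm hT (hlow _ (hmem x h0 h1) T hT')]
    rcases le_total (b + c) (((a + b) ^ 2 - c ^ 2 + 4 * Real.sqrt 3 * τ) / (4 * b)) with h1 | h1
    · refine hsuff 0 le_rfl ha0.le fun t ht ht' => ?_
      rw [min_eq_left h1]
      exact (hcfg 0 le_rfl ha0.le).cost_le_add hab hbc ht ht'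
    · have h3 : Real.sqrt 3 ^ 2 = 3 := Real.sq_sqrt (by norm_num)
      -- Equality in Cauchy–Schwarz means `√3 (a² + b² - c² - 2bs) = 4τ`, so `q` is the value of the
      -- bracket at the optimal `s = 2x - a`.
      obtain ⟨q, hq⟩ : ∃ q, q = 4 * τ / Real.sqrt 3 := ⟨_, rfl⟩
      have hq0 : 0 ≤ q := by rw [hq]; positivity
      have hq2 : 3 * q ^ 2 = 4 * b ^ 2 * c ^ 2 - (b ^ 2 + c ^ 2 - a ^ 2) ^ 2 := by
        rw [hq, div_pow, h3, ← hτ2]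
        ring
      have hqτ : 4 * Real.sqrt 3 * τ = 3 * q := by
        have h4 : q * Real.sqrt 3 = 4 * τ := by
          rw [hq, div_mul_cancel₀ _ (by positivity)]
        linear_combination (-Real.sqrt 3) * h4 + q * h3
      rw [hqτ] at h1 hsuff ⊢
      obtain ⟨x, hx⟩ : ∃ x, 2 * b * (2 * x - a) = a ^ 2 + b ^ 2 - c ^ 2 - q :=
        ⟨(a + (a ^ 2 + b ^ 2 - c ^ 2 - q) / (2 * b)) / 2, by field_simp; ring⟩
      have hqk := le_of_heron ha0 hab hbc hb0 hc0 hq2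
      have hx0 : 0 ≤ x := by
        by_contra! hneg
        nlinarith
      have hxa : x ≤ a := by
        by_contra! hlt
        nlinarith
      refine hsuff x hx0 hxa fun t ht ht' => ?_
      rw [min_eq_right h1]
      exact (hcfg x hx0 hxa).cost_le_of_optimal hab hbc hobt hq0 hq2 hx ht ht'
  · rintro T ⟨S, hS, hT⟩
    exact hlow S hS T hT
  -- At `x = (a - c)/2` one has `x + c = y`: the agents are at `A` and `C` at the same moment.
  · have h0 : 0 ≤ (a - c) / 2 := by linarith
    have h1 : (a - c) / 2 ≤ a := by linarith
    obtain ⟨T, hT, hT'⟩ := hup _ (hmem _ h0 h1)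
    have h2 := (hcfg _ h0 h1).cost_y_le_worst hT'
    rw [(hcfg _ h0 h1).cost_y_eq_upper (by ring)] at h2
    refine ⟨_, hmem _ h0 h1, ?_⟩
    rwa [← le_antisymm hT h2]
  · rintro T ⟨S, hS, hT⟩
    obtain ⟨T', hle', hT'⟩ := hup S hS
    rwa [hT.2.unique hT'.2]
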